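/- Let $n\ge 2$ and let $\mathbf A$ be a real $n\times n$ matrix with nonnegative entries. Let $\mathbf A^{(2)}$ be its second compound matrix, whose rows and columns are indexed by the pairs $(i,j)$, $1\le i<j\le n$ (ordered lexicographically), and whose entry at $((i,j),(k,l))$ is the minor of $\mathbf A$ with rows $i,j$ and columns $k,l$. A square real matrix $(b_{\alpha\beta})$ is called $\mathcal J$-sign-symmetric if there is a subset $\mathcal J$ of its index set such that $b_{\alpha\beta}\le 0$ whenever exactly one of $\alpha,\beta$ lies in $\mathcal J$, and $b_{\alpha\beta}<0$ only if exactly one of $\alpha,\beta$ lies in $\mathcal J$. To a set $\mathcal J$ of pairs $(i,j)$, $i<j$, corresponds the set $W\subseteq\{1,\dots,n\}^2$ that consists of all $(i,i)$, of all $(i,j)$ with $i<j$ and $(i,j)\in\mathcal J$, and of all $(i,j)$ with $i>j$ and $(j,i)\notin\mathcal J$; $W$ is called transitive if the relation $i\prec j\iff (i,j)\in W$ is a linear order on $\{1,\dots,n\}$. Suppose that $\mathbf A^{(2)}$ is $\mathcal J$-sign-symmetric and that the set $W$ corresponding to one of the possible sets $\mathcal J$ for $\mathbf A^{(2)}$ is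 transitive. Then the two largest in modulus eigenvalues of $\mathbf A$ are nonnegative; that is, the complex eigenvalues of $\mathbf A$, repeated according to multiplicity, can be enumerated as $\lambda_1,\dots,\lambda_n$ with $|\lambda_1|\ge|\lambda_2|\ge\dots\ge|\lambda_n|$ in such a way that $\lambda_1$ and $\lambda_2$ are real and nonnegative. -/

import Mathlib

/-- Unordered pairs of distinct indices, each written as `(i, j)` with `i < j`; they index the
rows and the columns of a second compound matrix. -/
abbrev PairIndex (n : ℕ) : Type := {p : Fin n × Fin n // p.1 < p.2}

/-- The generalized second-order minor of `A` with rows `i, j` and columns `k, l`. -/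
def genMinor {n : ℕ} (A : Matrix (Fin n) (Fin n) ℝ) (i j k l : Fin n) : ℝ :=
  (A.submatrix ![i, j] ![k, l]).det

/-- The second compound matrix of `A`: its entry at `((i, j), (k, l))`, `i < j`, `k < l`, is the
minor of `A` with rows `i, j` and columns `k, l`. -/
def secondCompound {n : ℕ} (A : Matrix (Fin n) (Fin n) ℝ) :
    Matrix (PairIndex n) (PairIndex n) ℝ :=
  Matrix.of fun p q => genMinor A p.1.1 p.1.2 q.1.1 q.1.2

/-- One of the two indices belongs to `J`, and the other belongs to the complement of `J`. -/
def Separates {ι : Type*} (J : Set ι) (a b : ι) : Prop :=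
  (a ∈ J ∧ b ∉ J) ∨ (a ∉ J ∧ b ∈ J)

/-- `J` is a possible index set in the definition of `𝒥`-sign-symmetry of `B`: the entries of `B`
at positions separated by `J` are nonpositive, and only those can be negative. -/
def IsSignSymmetricSet {ι : Type*} (B : Matrix ι ι ℝ) (J : Set ι) : Prop :=
  (∀ a b, Separates J a b → B a b ≤ 0) ∧ (∀ a b, B a b < 0 → Separates J a b)

/-- A matrix is `𝒥`-sign-symmetric if some index set `J` fits it. -/
def IsJSignSymmetric {ι : Type*} (B : Matrix ι ι ℝ) : Prop :=
  ∃ J : Set ι, IsSignSymmetricSet B J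

/-- The set `W` corresponding to the index set `J`: besides the diagonal, it contains `(i, j)` with
`i < j` if the pair `(i, j)` is in `J`, and `(i, j)` with `j < i` if `(j, i)` is not in `J`. -/
def associatedSet {n : ℕ} (J : Set (PairIndex n)) : Set (Fin n × Fin n) :=
  {p | p.1 = p.2 ∨ (∃ h : p.1 < p.2, (⟨(p.1, p.2), h⟩ : PairIndex n) ∈ J) ∨
    (∃ h : p.2 < p.1, (⟨(p.2, p.1), h⟩ : PairIndex n) ∉ J)}

/-- `W` is transitive if the binary relation it defines is a linear order relation. -/
def IsTransitiveSet {n : ℕ} (W : Set (Fin n × Fin n)) : Prop :=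
  IsLinearOrder (Fin n) (fun i j => (i, j) ∈ W)

/-- `ev` lists all complex eigenvalues of `A`, repeated according to algebraic multiplicity, in
order of decreasing modulus. -/
def IsEigenvalueEnumeration {n : ℕ} (A : Matrix (Fin n) (Fin n) ℝ) (ev : Fin n → ℂ) : Prop :=
  (A.map (algebraMap ℝ ℂ)).charpoly.roots = Finset.univ.val.map ev ∧
    Antitone (fun i => ‖ev i‖)

open Polynomial Filter Topology

/-! ### Complex numbers with nonnegative power sums -/

/-! Rearranging indices by the order `W` makes all second-order minors of `A` nonnegative; an
injective rank function `f` records the order (`IsTotallyNonnegTwo`). By Cauchy–Binet this class is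
closed under products, so for every `m` both `tr (A ^ m)` and `(tr (A ^ m)) ^ 2 - tr (A ^ (2 * m))`
are nonnegative. These are the power sums of the eigenvalues and of their products over ordered
pairs of distinct positions.

A finite family with nonnegative power sums contains its largest modulus
(`exists_eq_norm_of_power_sums_nonneg`), so `|λ₁||λ₂|` is a product of two eigenvalues. If `|λ₁| >
|λ₂| > 0`, one factor must be `λ₁ = |λ₁|`, and the other is then `|λ₂|`. If the two moduli agree, a
positive diagonal forces every eigenvalue of maximal modulus to be nonnegative
(`peripheral_eigenvalue_eq_norm`). Positivity of the diagonal comes from replacing `A` by `G * A *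
G` with Gaussian `G → 1`, followed by a compactness argument. -/

lemma norm_geom_sum_sub_le {w : ℂ} (hw : ‖w‖ ≤ 1) (N : ℕ) :
    ‖∑ m ∈ Finset.range N, w ^ m - (if w = 1 then (N : ℂ) else 0)‖ ≤ 2 / ‖w - 1‖ := by
  by_cases h : w = 1
  -- Here the bound is `2 / 0 = 0`, and the difference is exactly zero.
  · simp [h]
  · have h1 : 0 < ‖w - 1‖ := norm_pos_iff.2 (sub_ne_zero.2 h)
    rw [if_neg h, sub_zero, le_div_iff₀ h1, ← norm_mul, geom_sum_mul]
    calc ‖w ^ N - 1‖ ≤ ‖w ^ N‖ + ‖(1 : ℂ)‖ := norm_sub_le _ _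
      _ ≤ 2 := by
        rw [norm_pow, norm_one]
        linarith [pow_le_one₀ (norm_nonneg w) hw (n := N)]

/-- The sums of the geometric partial sums grow like the number of terms equal to one. -/
lemma norm_sum_geom_sum_sub_le {ι : Type*} (s : Finset ι) (w : ι → ℂ) (hw : ∀ i ∈ s, ‖w i‖ ≤ 1)
    (N : ℕ) :
    ‖∑ m ∈ Finset.range N, ∑ i ∈ s, w i ^ m - ((s.filter (fun i => w i = 1)).card : ℂ) * N‖
      ≤ ∑ i ∈ s, 2 / ‖w i - 1‖ := by
  have : ∑ m ∈ Finset.range N, ∑ i ∈ s, w i ^ m - ((s.filter (fun i => w i = 1)).card : ℂ) * N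
      = ∑ i ∈ s, (∑ m ∈ Finset.range N, w i ^ m - (if w i = 1 then (N : ℂ) else 0)) := by
    rw [Finset.sum_sub_distrib, Finset.sum_comm, ← Finset.sum_filter, Finset.sum_const,
      nsmul_eq_mul]
  rw [this]
  exact (norm_sum_le _ _).trans (Finset.sum_le_sum fun i hi => norm_geom_sum_sub_le (hw i hi) N)

/-- A Pringsheim-type argument: if no `w j` is `1`, the partial sums of the power sums stay bounded.
Rotating the family by `(w k)⁻¹` produces a term equal to `1`, so the rotated partial sums grow
linearly; yet nonnegativity makes the unrotated ones dominate them. -/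
lemma exists_eq_one_of_power_sums_nonneg {ι : Type*} (s : Finset ι) (w : ι → ℂ)
    (hw : ∀ i ∈ s, ‖w i‖ ≤ 1) (hp : ∀ m : ℕ, ∃ r : ℝ, 0 ≤ r ∧ ∑ i ∈ s, w i ^ m = r)
    {k : ι} (hk : k ∈ s) (hk1 : ‖w k‖ = 1) : ∃ j ∈ s, w j = 1 := by
  by_contra! hne
  choose p hp0 hp using hp
  set u : ℂ := (w k)⁻¹ with hu
  have hu1 : ‖u‖ = 1 := by rw [hu, norm_inv, hk1, inv_one]
  have hwk : w k ≠ 0 := by rw [← norm_pos_iff, hk1]; exact one_pos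
  set C : ℝ := ∑ i ∈ s, 2 / ‖w i - 1‖
  set D : ℝ := ∑ i ∈ s, 2 / ‖u * w i - 1‖
  have key : ∀ N : ℕ, (N : ℝ) ≤ C + D := by
    intro N
    have h1 := norm_sum_geom_sum_sub_le s w hw N
    have h2 := norm_sum_geom_sum_sub_le s (fun i => u * w i)
      (fun i hi => by rw [norm_mul, hu1, one_mul]; exact hw i hi) N
    rw [Finset.filter_false_of_mem hne] at h1
    simp only [hp, Finset.card_empty, Nat.cast_zero, zero_mul, sub_zero, mul_pow,
      ← Finset.mul_sum] at h1 h2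
    have h3 : ‖∑ m ∈ Finset.range N, u ^ m * (p m : ℂ)‖
        ≤ ‖∑ m ∈ Finset.range N, (p m : ℂ)‖ := by
      rw [← Complex.ofReal_sum, Complex.norm_real, Real.norm_of_nonneg
        (Finset.sum_nonneg fun m _ => hp0 m)]
      refine (norm_sum_le _ _).trans (Finset.sum_le_sum fun m _ => ?_)
      rw [norm_mul, norm_pow, hu1, one_pow, one_mul, Complex.norm_real,
        Real.norm_of_nonneg (hp0 m)]
    have hcard : 1 ≤ (s.filter (fun i => u * w i = 1)).card :=
      Finset.card_pos.2 ⟨k, Finset.mem_filter.2 ⟨hk, inv_mul_cancel₀ hwk⟩⟩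
    have h4 : (N : ℝ) ≤ ‖((s.filter (fun i => u * w i = 1)).card : ℂ) * N‖ := by
      rw [norm_mul, Complex.norm_natCast, Complex.norm_natCast]
      exact le_mul_of_one_le_left (Nat.cast_nonneg _) (by exact_mod_cast hcard)
    have h5 := norm_le_norm_add_norm_sub
      (∑ m ∈ Finset.range N, u ^ m * (p m : ℂ)) (((s.filter (fun i => u * w i = 1)).card : ℂ) * N)
    linarith
  obtain ⟨N, hN⟩ := exists_nat_gt (C + D)
  exact absurd (key N) (not_le.2 hN)

/-- If all power sums of a finite family of complex numbers are nonnegative, then the largest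
modulus of the family belongs to the family. -/
lemma exists_eq_norm_of_power_sums_nonneg {ι : Type*} (s : Finset ι) (μ : ι → ℂ)
    (hp : ∀ m : ℕ, ∃ r : ℝ, 0 ≤ r ∧ ∑ i ∈ s, μ i ^ m = r)
    {k : ι} (hk : k ∈ s) (hmax : ∀ i ∈ s, ‖μ i‖ ≤ ‖μ k‖) : ∃ j ∈ s, μ j = (‖μ k‖ : ℂ) := by
  by_cases h0 : μ k = 0
  · exact ⟨k, hk, by simp [h0]⟩
  have hr : 0 < ‖μ k‖ := norm_pos_iff.2 h0
  have hrc : (‖μ k‖ : ℂ) ≠ 0 := by exact_mod_cast hr.ne'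
  obtain ⟨j, hj, h⟩ := exists_eq_one_of_power_sums_nonneg s (fun i => μ i / (‖μ k‖ : ℂ))
    (fun i hi => by
      rw [norm_div, Complex.norm_real, norm_norm]
      exact div_le_one_of_le₀ (hmax i hi) hr.le)
    (fun m => by
      obtain ⟨r, hr0, h⟩ := hp m
      refine ⟨r / ‖μ k‖ ^ m, by positivity, ?_⟩
      simp only [div_pow, ← Finset.sum_div, h]
      push_cast
      rfl)
    hk (by rw [norm_div, Complex.norm_real, norm_norm, div_self hr.ne'])
  exact ⟨j, hj, (div_eq_one_iff_eq hrc).1 h⟩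

/-! ### Traces of polynomials in a matrix -/

lemma roots_prod_X_sub_C_family {ι : Type*} [Fintype ι] (v : ι → ℂ) :
    (∏ i, (X - C (v i))).roots = Finset.univ.val.map v := by
  rw [← Polynomial.roots_multiset_prod_X_sub_C (Finset.univ.val.map v), Multiset.map_map]
  rfl

section Trace

variable {ι : Type*} [Fintype ι] [DecidableEq ι]

/-- Both sides are multiplicative in `q`, so constants and linear factors suffice; for the latter
this is the characteristic polynomial up to sign. -/
lemma det_aeval_of_charpoly_eq {A : Matrix ι ι ℂ} {ev : ι → ℂ}
    (h : A.charpoly = ∏ i, (X - C (ev i))) (q : ℂ[X]) :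
    (aeval A q).det = ∏ i, q.eval (ev i) := by
  have hlin : ∀ a : ℂ, (aeval A (X - C a)).det = ∏ i, (X - C a : ℂ[X]).eval (ev i) := by
    intro a
    have h1 : (aeval A (X - C a)) = -(Matrix.scalar ι a - A) := by
      simp [Matrix.algebraMap_eq_diagonal, Pi.algebraMap_def]
    rw [h1, Matrix.det_neg, ← Matrix.eval_charpoly, h, eval_prod, ← Finset.card_univ,
      ← Finset.prod_const, ← Finset.prod_mul_distrib]
    exact Finset.prod_congr rfl fun i _ => by simp
  have hprod : ∀ s : Multiset ℂ, (aeval A (s.map (fun a => X - C a)).prod).det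
      = ∏ i, (s.map (fun a => X - C a)).prod.eval (ev i) := by
    intro s
    induction s using Multiset.induction_on with
    | empty => simp
    | cons a s ih =>
      simp only [Multiset.map_cons, Multiset.prod_cons, map_mul, Matrix.det_mul, eval_mul,
        Finset.prod_mul_distrib, ih, hlin]
  rw [(IsAlgClosed.splits q).eq_prod_roots]
  simp only [map_mul, Matrix.det_mul, eval_mul, Finset.prod_mul_distrib, hprod]
  congr 1
  simp [Matrix.algebraMap_eq_diagonal, Pi.algebraMap_def]

lemma charpoly_aeval_of_charpoly_eq {A : Matrix ι ι ℂ} {ev : ι → ℂ}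
    (h : A.charpoly = ∏ i, (X - C (ev i))) (p : ℂ[X]) :
    (aeval A p).charpoly = ∏ i, (X - C (p.eval (ev i))) := by
  refine Polynomial.funext fun z => ?_
  have h1 : Matrix.scalar ι z - aeval A p = aeval A (C z - p) := by
    simp [Matrix.algebraMap_eq_diagonal, Pi.algebraMap_def]
  rw [Matrix.eval_charpoly, h1, det_aeval_of_charpoly_eq h, eval_prod]
  simp

lemma trace_aeval_of_charpoly_eq {A : Matrix ι ι ℂ} {ev : ι → ℂ}
    (h : A.charpoly = ∏ i, (X - C (ev i))) (p : ℂ[X]) :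
    (aeval A p).trace = ∑ i, p.eval (ev i) := by
  rw [Matrix.trace_eq_sum_roots_charpoly, charpoly_aeval_of_charpoly_eq h,
    roots_prod_X_sub_C_family]
  rfl

lemma sum_sub_pow_eq_trace {A : Matrix ι ι ℝ} {ev : ι → ℂ}
    (h : (A.map (algebraMap ℝ ℂ)).charpoly = ∏ i, (X - C (ev i))) (δ : ℝ) (m : ℕ) :
    ∑ i, (ev i - δ) ^ m = (((A - δ • (1 : Matrix ι ι ℝ)) ^ m).trace : ℂ) := by
  have h1 := trace_aeval_of_charpoly_eq h ((X - C (δ : ℂ)) ^ m)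
  simp only [eval_pow, eval_sub, eval_X, eval_C] at h1
  rw [← h1]
  have h2 : aeval (A.map (algebraMap ℝ ℂ)) ((X - C (δ : ℂ)) ^ m)
      = (algebraMap ℝ ℂ).mapMatrix ((A - δ • (1 : Matrix ι ι ℝ)) ^ m) := by
    rw [map_pow, map_pow, map_sub, map_sub, aeval_X, aeval_C]
    congr 2
    ext i j
    by_cases hij : i = j <;> simp [Matrix.algebraMap_matrix_apply, hij]
  rw [h2]
  simp [Matrix.trace]

lemma sum_pow_eq_trace {A : Matrix ι ι ℝ} {ev : ι → ℂ}
    (h : (A.map (algebraMap ℝ ℂ)).charpoly = ∏ i, (X - C (ev i))) (m : ℕ) :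
    ∑ i, ev i ^ m = ((A ^ m).trace : ℂ) := by
  simpa using sum_sub_pow_eq_trace h 0 m

end Trace

/-! ### Matrices with nonnegative entries and second-order minors -/

/-- The entries of `A` and its second-order minors, with rows and columns arranged by increasing
values of `f`, are nonnegative. -/
structure IsTotallyNonnegTwo {ι : Type*} (f : ι → ℝ) (A : Matrix ι ι ℝ) : Prop where
  nonneg : ∀ i j, 0 ≤ A i j
  minor : ∀ i j k l, f i ≤ f j → f k ≤ f l → A i l * A j k ≤ A i k * A j l

namespace IsTotallyNonnegTwo

variable {ι : Type*} {f : ι → ℝ} {A B : Matrix ι ι ℝ}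

/-- Cauchy–Binet, summed over all ordered pairs `(p, q)`, hence the factor 2. Exchanging `p` and `q`
flips both minors, so their product is nonnegative in either order. -/
lemma mul [Fintype ι] (hA : IsTotallyNonnegTwo f A) (hB : IsTotallyNonnegTwo f B) :
    IsTotallyNonnegTwo f (A * B) where
  nonneg i j := Finset.sum_nonneg fun p _ => mul_nonneg (hA.nonneg i p) (hB.nonneg p j)
  minor i j k l hij hkl := by
    have h1 : ∀ a b c d, (A * B) a b * (A * B) c d
        = ∑ p, ∑ q, A a p * B p b * (A c q * B q d) := fun a b c d => by
      rw [Matrix.mul_apply, Matrix.mul_apply, Finset.sum_mul_sum]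
    have h2 : ∀ a b c d, (A * B) a b * (A * B) c d
        = ∑ p, ∑ q, A a q * B q b * (A c p * B p d) := fun a b c d => by
      rw [h1, Finset.sum_comm]
    have h3 : 0 ≤ ∑ p, ∑ q, (A i p * A j q - A i q * A j p) * (B p k * B q l - B p l * B q k) := by
      refine Finset.sum_nonneg fun p _ => Finset.sum_nonneg fun q _ => ?_
      rcases le_total (f p) (f q) with h | h
      · exact mul_nonneg (sub_nonneg.2 (hA.minor i j p q hij h))
          (sub_nonneg.2 (hB.minor p q k l h hkl))
      · have ha := hA.minor i j q p hij h
        have hb := hB.minor q p k l h hkl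
        exact mul_nonneg_of_nonpos_of_nonpos (by linarith) (by linarith)
    have h4 : ∑ p, ∑ q, (A i p * A j q - A i q * A j p) * (B p k * B q l - B p l * B q k)
        = 2 * ((A * B) i k * (A * B) j l - (A * B) i l * (A * B) j k) := by
      have : 2 * ((A * B) i k * (A * B) j l - (A * B) i l * (A * B) j k)
          = ((A * B) i k * (A * B) j l + (A * B) i k * (A * B) j l)
            - ((A * B) i l * (A * B) j k + (A * B) i l * (A * B) j k) := by ring
      rw [this]
      nth_rewrite 1 [h1 i k j l]
      nth_rewrite 1 [h2 i k j l]
      nth_rewrite 1 [h1 i l j k]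
      nth_rewrite 1 [h2 i l j k]
      simp only [← Finset.sum_add_distrib, ← Finset.sum_sub_distrib]
      exact Finset.sum_congr rfl fun p _ => Finset.sum_congr rfl fun q _ => by ring
    linarith

lemma one [DecidableEq ι] (hf : Function.Injective f) :
    IsTotallyNonnegTwo f (1 : Matrix ι ι ℝ) where
  nonneg i j := by
    rw [Matrix.one_apply]; split_ifs <;> norm_num
  minor i j k l hij hkl := by
    have hnn : ∀ a b : ι, (0 : ℝ) ≤ (1 : Matrix ι ι ℝ) a b := fun a b => by
      rw [Matrix.one_apply]; split_ifs <;> norm_num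
    by_cases h1 : i = l
    · by_cases h2 : j = k
      · subst h1 h2
        -- A tie in `f` would allow the minor of a transposition, which is `-1`.
        have : i = j := hf (le_antisymm hij hkl)
        subst this
        exact le_rfl
      · rw [Matrix.one_apply_ne h2, mul_zero]
        exact mul_nonneg (hnn _ _) (hnn _ _)
    · rw [Matrix.one_apply_ne h1, zero_mul]
      exact mul_nonneg (hnn _ _) (hnn _ _)

lemma pow [Fintype ι] [DecidableEq ι] (hf : Function.Injective f) (hA : IsTotallyNonnegTwo f A)
    (m : ℕ) : IsTotallyNonnegTwo f (A ^ m) := by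
  induction m with
  | zero => rw [pow_zero]; exact one hf
  | succ m ih => rw [pow_succ]; exact ih.mul hA

/-- The difference is a sum of principal minors over all ordered pairs of indices. -/
lemma trace_mul_self_le [Fintype ι] (hA : IsTotallyNonnegTwo f A) :
    (A * A).trace ≤ A.trace ^ 2 := by
  rw [sq, Matrix.trace, Matrix.trace, Finset.sum_mul_sum]
  refine Finset.sum_le_sum fun i _ => ?_
  rw [Matrix.diag_apply, Matrix.mul_apply]
  refine Finset.sum_le_sum fun j _ => ?_
  rcases le_total (f i) (f j) with h | h
  · exact hA.minor i j i j h h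
  · have := hA.minor j i j i h h
    simp only [Matrix.diag_apply]
    linarith

end IsTotallyNonnegTwo

lemma matrix_pow_nonneg {ι : Type*} [Fintype ι] [DecidableEq ι] {A : Matrix ι ι ℝ}
    (hA : ∀ i j, 0 ≤ A i j) (m : ℕ) (i j : ι) : 0 ≤ (A ^ m) i j := by
  induction m generalizing i j with
  | zero => rw [pow_zero, Matrix.one_apply]; split_ifs <;> norm_num
  | succ m ih =>
    rw [pow_succ]
    exact Finset.sum_nonneg fun p _ => mul_nonneg (ih i p) (hA p j)

/-- The disc of radius `r` about `δ` touches the circle of radius `r + δ` about `0` only at `r + δ`.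
-/
lemma Complex.eq_of_norm_sub_le_of_norm_eq_add {z : ℂ} {r δ : ℝ} (hδ : 0 < δ)
    (h1 : ‖z - δ‖ ≤ r) (h2 : ‖z‖ = r + δ) : z = ((r + δ : ℝ) : ℂ) := by
  have hr : 0 ≤ r := (norm_nonneg _).trans h1
  have e1 : (z.re - δ) ^ 2 + z.im ^ 2 ≤ r ^ 2 := by
    have := pow_le_pow_left₀ (norm_nonneg _) h1 2
    rw [Complex.sq_norm, Complex.normSq_apply] at this
    simp at this
    nlinarith
  have e2 : z.re ^ 2 + z.im ^ 2 = (r + δ) ^ 2 := by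
    rw [← h2, Complex.sq_norm, Complex.normSq_apply]; ring
  have h3 : r + δ ≤ z.re := by
    have : 0 ≤ δ * (z.re - (r + δ)) := by nlinarith
    linarith [nonneg_of_mul_nonneg_right this hδ]
  have h4 : z.im = 0 := by
    have : z.im ^ 2 ≤ 0 := by nlinarith
    exact pow_eq_zero_iff (two_ne_zero) |>.1 (le_antisymm this (sq_nonneg _))
  apply Complex.ext
  · rw [Complex.ofReal_re]
    refine le_antisymm ?_ h3
    rw [← h2]; exact Complex.re_le_norm z
  · rw [Complex.ofReal_im, h4]

/-- Eigenvalues of largest modulus of a nonnegative matrix with positive diagonal. -/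
lemma peripheral_eigenvalue_eq_norm {ι : Type*} [Fintype ι] [DecidableEq ι] [Nonempty ι]
    {A : Matrix ι ι ℝ} (hA : ∀ i j, 0 ≤ A i j) (hd : ∀ i, 0 < A i i) {ev : ι → ℂ}
    (h : (A.map (algebraMap ℝ ℂ)).charpoly = ∏ i, (X - C (ev i)))
    {k : ι} (hk : ∀ i, ‖ev i‖ ≤ ‖ev k‖) : ev k = (‖ev k‖ : ℂ) := by
  -- Subtracting the least diagonal entry keeps the matrix nonnegative, so the power sums of the
  -- shifted eigenvalues are nonnegative too.
  obtain ⟨a, ha⟩ := Finite.exists_min (fun i => A i i)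
  set δ := A a a
  have hδ : 0 < δ := hd a
  have hB : ∀ i j, 0 ≤ (A - δ • (1 : Matrix ι ι ℝ)) i j := by
    intro i j
    rcases eq_or_ne i j with rfl | hij
    · simpa using ha i
    · simpa [Matrix.one_apply_ne hij] using hA i j
  obtain ⟨b, hb⟩ := Finite.exists_max (fun i => ‖ev i - δ‖)
  obtain ⟨j, -, hj⟩ := exists_eq_norm_of_power_sums_nonneg Finset.univ (fun i => ev i - δ)
    (fun m => ⟨_, Finset.sum_nonneg fun i _ => matrix_pow_nonneg hB m i i,
      sum_sub_pow_eq_trace h δ m⟩) (Finset.mem_univ b) (fun i _ => hb i)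
  set r := ‖ev b - δ‖
  have hr : 0 ≤ r := norm_nonneg _
  have hj' : ev j = ((r + δ : ℝ) : ℂ) := by
    push_cast
    exact sub_eq_iff_eq_add.1 hj
  have hup : ‖ev k‖ ≤ r + δ := by
    calc ‖ev k‖ = ‖(ev k - δ) + (δ : ℂ)‖ := by rw [sub_add_cancel]
      _ ≤ ‖ev k - δ‖ + ‖(δ : ℂ)‖ := norm_add_le _ _
      _ ≤ r + δ := by
        rw [Complex.norm_real, Real.norm_of_nonneg hδ.le]
        exact add_le_add_left (hb k) _
  have hlo : r + δ ≤ ‖ev k‖ := by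
    have := hk j
    rwa [hj', Complex.norm_real, Real.norm_of_nonneg (by positivity)] at this
  have heq := le_antisymm hup hlo
  rw [heq]
  exact Complex.eq_of_norm_sub_le_of_norm_eq_add hδ (hb k) heq

/-- The power sums of the products over ordered pairs of distinct indices are nonnegative by
`trace_mul_self_le` applied to `A ^ m`. -/
lemma exists_mul_eq_norm_mul {n : ℕ} {f : Fin n → ℝ} (hf : Function.Injective f)
    {A : Matrix (Fin n) (Fin n) ℝ} (hA : IsTotallyNonnegTwo f A) {ev : Fin n → ℂ}
    (h : (A.map (algebraMap ℝ ℂ)).charpoly = ∏ i, (X - C (ev i)))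
    {a b : Fin n} (hab : a ≠ b) (ha : ∀ i, ‖ev i‖ ≤ ‖ev a‖) (hb : ∀ i, i ≠ a → ‖ev i‖ ≤ ‖ev b‖) :
    ∃ i j, i ≠ j ∧ ev i * ev j = ((‖ev a‖ * ‖ev b‖ : ℝ) : ℂ) := by
  obtain ⟨p, hp, hpe⟩ := exists_eq_norm_of_power_sums_nonneg
    (Finset.univ : Finset (Fin n)).offDiag (fun p => ev p.1 * ev p.2)
    (fun m => by
      refine ⟨(A ^ m).trace ^ 2 - (A ^ m * A ^ m).trace,
        sub_nonneg.2 (hA.pow hf m).trace_mul_self_le, ?_⟩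
      have h1 := Finset.sum_product' Finset.univ Finset.univ (fun i j => (ev i * ev j) ^ m)
      rw [← Finset.diag_union_offDiag, Finset.sum_union (Finset.disjoint_diag_offDiag _),
        Finset.sum_diag] at h1
      rw [← pow_add]
      push_cast
      rw [← sum_pow_eq_trace h m, ← sum_pow_eq_trace h (m + m), eq_sub_iff_add_eq']
      calc _ = ∑ i, ∑ j, (ev i * ev j) ^ m := by
            rw [← h1]; simp only [mul_pow, pow_add]
        _ = _ := by simp only [mul_pow, sq, Finset.sum_mul_sum])
    (k := (a, b)) (by simpa using hab)
    (by
      rintro ⟨i, j⟩ hij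
      rw [Finset.mem_offDiag] at hij
      simp only [norm_mul]
      by_cases hi : i = a
      · subst hi
        exact mul_le_mul_of_nonneg_left (hb j hij.2.2.symm) (norm_nonneg _)
      · rw [mul_comm]
        exact mul_le_mul (ha j) (hb i hi) (norm_nonneg _) (norm_nonneg _))
  refine ⟨p.1, p.2, (Finset.mem_offDiag.1 hp).2.2, ?_⟩
  simpa using hpe

/-! ### Enumerations of the eigenvalues -/

/-- An enumeration of the eigenvalues by decreasing modulus that starts with two nonnegative
numbers. -/
structure IsGoodEnumeration {n : ℕ} (A : Matrix (Fin n) (Fin n) ℝ)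
    (ev : Fin n → ℂ) : Prop where
  charpoly : ∀ z : ℂ, (A.map (algebraMap ℝ ℂ)).charpoly.eval z = ∏ i, (z - ev i)
  antitone : ∀ i j, i ≤ j → ‖ev j‖ ≤ ‖ev i‖
  eq_norm : ∀ i : Fin n, (i : ℕ) ≤ 1 → ev i = (‖ev i‖ : ℂ)

lemma exists_antitone_eigenvalues {n : ℕ} (A : Matrix (Fin n) (Fin n) ℂ) :
    ∃ ev : Fin n → ℂ, A.charpoly = ∏ i, (X - C (ev i)) ∧ Antitone fun i => ‖ev i‖ := by
  have hs := IsAlgClosed.splits A.charpoly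
  have hc : A.charpoly.roots.card = n := by
    rw [← hs.natDegree_eq_card_roots, Matrix.charpoly_natDegree_eq_dim, Fintype.card_fin]
  obtain ⟨l, hl⟩ := Quot.exists_rep A.charpoly.roots
  change (l : Multiset ℂ) = _ at hl
  have hlen : l.length = n := by rw [← hc, ← hl, Multiset.coe_card]
  subst hlen
  set σ := Tuple.sort (fun i => -‖l.get i‖)
  refine ⟨l.get ∘ σ, ?_, ?_⟩
  · have hσ := Equiv.prod_comp σ (fun i => X - C (l.get i))
    simp only [Function.comp_apply]
    rw [hσ]
    conv_lhs => rw [hs.eq_prod_roots_of_monic A.charpoly_monic, ← hl]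
    rw [Multiset.map_coe, Multiset.prod_coe, ← List.prod_ofFn]
    congr 1
    refine List.ext_get (by simp) fun i h1 h2 => by simp
  · intro i j hij
    have := Tuple.monotone_sort (fun i => -‖l.get i‖) hij
    simpa only [Function.comp_apply, neg_le_neg_iff] using this

lemma IsTotallyNonnegTwo.exists_isGoodEnumeration_of_diag_pos {n : ℕ} (hn : 2 ≤ n) {f : Fin n → ℝ}
    (hf : Function.Injective f) {A : Matrix (Fin n) (Fin n) ℝ} (hA : IsTotallyNonnegTwo f A)
    (hd : ∀ i, 0 < A i i) : ∃ ev, IsGoodEnumeration A ev := by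
  obtain ⟨ev, h, hanti⟩ := exists_antitone_eigenvalues (A.map (algebraMap ℝ ℂ))
  set a : Fin n := ⟨0, Nat.zero_lt_of_lt hn⟩ with ha_def
  set b : Fin n := ⟨1, hn⟩ with hb_def
  have : Nonempty (Fin n) := ⟨a⟩
  have hab : a ≠ b := by simp [ha_def, hb_def]
  have ha : ∀ i, ‖ev i‖ ≤ ‖ev a‖ := fun i => hanti (by simp [ha_def, Fin.le_def])
  have hb : ∀ i, i ≠ a → ‖ev i‖ ≤ ‖ev b‖ := fun i hi => hanti (by
    rw [ne_eq, Fin.ext_iff] at hi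
    simp only [hb_def, Fin.le_def]
    simp only [ha_def] at hi
    omega)
  have h0 := peripheral_eigenvalue_eq_norm hA.nonneg hd h ha
  have hch : ∀ z : ℂ, (A.map (algebraMap ℝ ℂ)).charpoly.eval z = ∏ i, (z - ev i) := fun z => by
    rw [h, eval_prod]; simp
  -- `ev b` itself need not be nonnegative: several eigenvalues may share its modulus. The suitable
  -- one is later swapped into position `b`.
  have hmain : ∃ j, j ≠ a ∧ ‖ev j‖ = ‖ev b‖ ∧ ev j = (‖ev j‖ : ℂ) := by
    rcases (ha b).eq_or_lt with heq | hlt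
    · exact ⟨b, hab.symm, rfl, peripheral_eigenvalue_eq_norm hA.nonneg hd h
        (fun i => heq ▸ ha i)⟩
    by_cases hb0 : ev b = 0
    · exact ⟨b, hab.symm, rfl, by simp [hb0]⟩
    have hbpos : 0 < ‖ev b‖ := norm_pos_iff.2 hb0
    have hapos : 0 < ‖ev a‖ := hbpos.trans hlt
    have ha0 : (‖ev a‖ : ℂ) ≠ 0 := by exact_mod_cast hapos.ne'
    have hfin : ∀ j, ev a * ev j = ((‖ev a‖ * ‖ev b‖ : ℝ) : ℂ) → j ≠ a →
        ∃ j, j ≠ a ∧ ‖ev j‖ = ‖ev b‖ ∧ ev j = (‖ev j‖ : ℂ) := by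
      intro j hj hja
      rw [h0] at hj
      simp only [Complex.norm_real, norm_norm] at hj
      push_cast at hj
      have e := mul_left_cancel₀ ha0 hj
      have e' : ‖ev j‖ = ‖ev b‖ := by rw [e, Complex.norm_real, norm_norm]
      exact ⟨j, hja, e', by rw [e']; exact e⟩
    obtain ⟨i, j, hij, he⟩ := exists_mul_eq_norm_mul hf hA h hab ha hb
    by_cases hi : i = a
    · subst hi
      exact hfin j he hij.symm
    by_cases hj : j = a
    · subst hj
      rw [mul_comm (ev i)] at he
      exact hfin i he hij
    -- With neither factor at `a`, the product has modulus at most `‖ev b‖ ^ 2`, which is too small.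
    have hn1 := congrArg norm he
    rw [norm_mul, Complex.norm_real, Real.norm_of_nonneg (by positivity)] at hn1
    have h2 : ‖ev i‖ * ‖ev j‖ ≤ ‖ev b‖ * ‖ev b‖ :=
      mul_le_mul (hb i hi) (hb j hj) (norm_nonneg _) (norm_nonneg _)
    have h3 : ‖ev b‖ * ‖ev b‖ < ‖ev a‖ * ‖ev b‖ := mul_lt_mul_of_pos_right hlt hbpos
    linarith
  obtain ⟨j, hja, hjb, hj⟩ := hmain
  have hnorm : ∀ i, ‖ev (Equiv.swap b j i)‖ = ‖ev i‖ := by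
    intro i
    rcases eq_or_ne i b with rfl | hib
    · rw [Equiv.swap_apply_left, hjb]
    rcases eq_or_ne i j with rfl | hij
    · rw [Equiv.swap_apply_right, hjb]
    · rw [Equiv.swap_apply_of_ne_of_ne hib hij]
  refine ⟨ev ∘ Equiv.swap b j, ?_, ?_, ?_⟩
  · intro z
    rw [hch z]
    exact (Equiv.prod_comp (Equiv.swap b j) (fun i => z - ev i)).symm
  · intro i i' hii
    simp only [Function.comp_apply, hnorm]
    exact hanti hii
  · intro i hi
    simp only [Function.comp_apply, hnorm]
    obtain rfl | rfl : i = a ∨ i = b := by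
      simp only [ha_def, hb_def, Fin.ext_iff]
      omega
    · rw [Equiv.swap_apply_of_ne_of_ne hab hja.symm]
      exact h0
    · rw [Equiv.swap_apply_left, ← hjb]
      exact hj

/-! ### Passage to the limit -/

/-- Gershgorin's theorem; the bound is continuous in the entries, hence uniform along a convergent
sequence. -/
lemma norm_le_sum_norm_of_isRoot_charpoly {ι : Type*} [Fintype ι] [DecidableEq ι]
    {A : Matrix ι ι ℂ} {z : ℂ} (hz : A.charpoly.IsRoot z) : ‖z‖ ≤ ∑ i, ∑ j, ‖A i j‖ := by
  have hz' : Module.End.HasEigenvalue (Matrix.toLin' A) z := by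
    rw [Module.End.hasEigenvalue_iff_mem_spectrum, Matrix.spectrum_toLin',
      Matrix.mem_spectrum_iff_isRoot_charpoly]
    exact hz
  obtain ⟨k, hk⟩ := eigenvalue_mem_ball hz'
  rw [mem_closedBall_iff_norm] at hk
  calc ‖z‖ = ‖A k k + (z - A k k)‖ := by rw [add_sub_cancel]
    _ ≤ ‖A k k‖ + ‖z - A k k‖ := norm_add_le _ _
    _ ≤ ‖A k k‖ + ∑ j ∈ Finset.univ.erase k, ‖A k j‖ := by gcongr
    _ = ∑ j, ‖A k j‖ := Finset.add_sum_erase _ (fun j => ‖A k j‖) (Finset.mem_univ k)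
    _ ≤ ∑ i, ∑ j, ‖A i j‖ := Finset.single_le_sum (f := fun i => ∑ j, ‖A i j‖)
        (fun i _ => Finset.sum_nonneg fun j _ => norm_nonneg _) (Finset.mem_univ k)

/-- The enumerations lie in a fixed compact ball, and every condition of `IsGoodEnumeration` is
closed, so a subsequential limit satisfies them. -/
lemma exists_isGoodEnumeration_of_tendsto {n : ℕ} {A : Matrix (Fin n) (Fin n) ℝ}
    {B : ℕ → Matrix (Fin n) (Fin n) ℝ} (hB : Tendsto B atTop (𝓝 A))
    (h : ∀ t, ∃ ev, IsGoodEnumeration (B t) ev) : ∃ ev, IsGoodEnumeration A ev := by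
  choose ev hev using h
  have hcont : Continuous fun M : Matrix (Fin n) (Fin n) ℝ =>
      ∑ i, ∑ j, ‖(M.map (algebraMap ℝ ℂ)) i j‖ := by
    simp only [Matrix.map_apply]
    fun_prop
  obtain ⟨K, hK⟩ := ((hcont.tendsto A).comp hB).bddAbove_range
  have hbound : ∀ t, ev t ∈ Metric.closedBall (0 : Fin n → ℂ) (max K 0) := by
    intro t
    rw [mem_closedBall_zero_iff, pi_norm_le_iff_of_nonneg (le_max_right _ _)]
    intro i
    refine le_trans ?_ (le_max_left _ _)
    refine (norm_le_sum_norm_of_isRoot_charpoly ?_).trans (hK ⟨t, rfl⟩)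
    rw [Polynomial.IsRoot, (hev t).charpoly]
    exact Finset.prod_eq_zero (Finset.mem_univ i) (sub_self _)
  obtain ⟨e, -, φ, hφ, he⟩ :=
    (isCompact_closedBall (0 : Fin n → ℂ) (max K 0)).tendsto_subseq hbound
  have hei : ∀ i, Tendsto (fun t => ev (φ t) i) atTop (𝓝 (e i)) := tendsto_pi_nhds.1 he
  have hBφ : Tendsto (fun t => B (φ t)) atTop (𝓝 A) := hB.comp hφ.tendsto_atTop
  refine ⟨e, ?_, ?_, ?_⟩
  · intro z
    have hdet : Continuous fun M : Matrix (Fin n) (Fin n) ℝ =>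
        (M.map (algebraMap ℝ ℂ)).charpoly.eval z := by
      simp only [Matrix.eval_charpoly]
      refine Continuous.matrix_det (continuous_const.sub ?_)
      exact Continuous.matrix_map continuous_id Complex.continuous_ofReal
    have h1 := (hdet.tendsto A).comp hBφ
    refine tendsto_nhds_unique h1 ?_
    simp only [Function.comp_def, (hev _).charpoly]
    exact tendsto_finsetProd _ fun i _ => tendsto_const_nhds.sub (hei i)
  · intro i j hij
    exact le_of_tendsto_of_tendsto' (hei j).norm (hei i).norm
      fun t => (hev (φ t)).antitone i j hij
  · intro i hi
    refine tendsto_nhds_unique (hei i) ?_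
    refine Tendsto.congr (fun t => ((hev (φ t)).eq_norm i hi).symm) ?_
    exact (Complex.continuous_ofReal.tendsto _).comp (hei i).norm

/-! ### Gaussian smoothing -/

/-- The Gaussian kernel matrix at the nodes `f i`. -/
noncomputable def gaussianMatrix {ι : Type*} (f : ι → ℝ) (t : ℝ) : Matrix ι ι ℝ :=
  Matrix.of fun i j => Real.exp (-(t * (f i - f j) ^ 2))

lemma gaussianMatrix_pos {ι : Type*} (f : ι → ℝ) (t : ℝ) (i j : ι) :
    0 < gaussianMatrix f t i j := Real.exp_pos _

/-- The exponents of the two products differ by `2 * t * (f j - f i) * (f l - f k)`. -/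
lemma isTotallyNonnegTwo_gaussianMatrix {ι : Type*} (f : ι → ℝ) {t : ℝ} (ht : 0 ≤ t) :
    IsTotallyNonnegTwo f (gaussianMatrix f t) where
  nonneg i j := (gaussianMatrix_pos f t i j).le
  minor i j k l hij hkl := by
    simp only [gaussianMatrix, Matrix.of_apply]
    rw [← Real.exp_add, ← Real.exp_add, Real.exp_le_exp]
    have := mul_nonneg ht (mul_nonneg (sub_nonneg.2 hij) (sub_nonneg.2 hkl))
    nlinarith

lemma tendsto_gaussianMatrix {ι : Type*} [DecidableEq ι] {f : ι → ℝ}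
    (hf : Function.Injective f) :
    Tendsto (fun t : ℕ => gaussianMatrix f t) atTop (𝓝 1) := by
  refine tendsto_pi_nhds.2 fun i => tendsto_pi_nhds.2 fun j => ?_
  simp only [gaussianMatrix, Matrix.of_apply]
  rcases eq_or_ne i j with rfl | hij
  · simp
  · rw [Matrix.one_apply_ne hij]
    refine Real.tendsto_exp_atBot.comp (tendsto_neg_atTop_atBot.comp ?_)
    refine tendsto_natCast_atTop_atTop.atTop_mul_const ?_
    have : f i - f j ≠ 0 := sub_ne_zero.2 (hf.ne hij)
    positivity

lemma IsTotallyNonnegTwo.exists_isGoodEnumeration {n : ℕ} (hn : 2 ≤ n) {f : Fin n → ℝ}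
    (hf : Function.Injective f) {A : Matrix (Fin n) (Fin n) ℝ} (hA : IsTotallyNonnegTwo f A) :
    ∃ ev, IsGoodEnumeration A ev := by
  -- Smoothing creates a positive diagonal only if some entry of `A` is positive.
  by_cases h0 : A = 0
  · subst h0
    refine ⟨0, fun z => ?_, fun i j _ => by simp, fun i _ => by simp⟩
    have : (0 : Matrix (Fin n) (Fin n) ℝ).map (algebraMap ℝ ℂ) = 0 := by ext; simp
    rw [this, Matrix.charpoly_zero]
    simp
  obtain ⟨p, q, hpq⟩ : ∃ p q, 0 < A p q := by
    by_contra! hle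
    exact h0 (Matrix.ext fun i j => le_antisymm (hle i j) (hA.nonneg i j))
  have hlim : Tendsto (fun t : ℕ => gaussianMatrix f t * A * gaussianMatrix f t) atTop (𝓝 A) := by
    have hG := tendsto_gaussianMatrix hf
    have hc : Continuous fun M : Matrix (Fin n) (Fin n) ℝ => M * A * M := by fun_prop
    simpa [Function.comp_def] using (hc.tendsto 1).comp hG
  refine exists_isGoodEnumeration_of_tendsto hlim fun t => ?_
  have hG := isTotallyNonnegTwo_gaussianMatrix f (Nat.cast_nonneg (α := ℝ) t)
  refine ((hG.mul hA).mul hG).exists_isGoodEnumeration_of_diag_pos hn hf fun i => ?_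
  rw [Matrix.mul_apply]
  refine Finset.sum_pos' (fun a _ => mul_nonneg ((hG.mul hA).nonneg _ _) (hG.nonneg _ _))
    ⟨q, Finset.mem_univ q, mul_pos ?_ (gaussianMatrix_pos _ _ _ _)⟩
  rw [Matrix.mul_apply]
  exact Finset.sum_pos' (fun a _ => mul_nonneg (hG.nonneg _ _) (hA.nonneg _ _))
    ⟨p, Finset.mem_univ p, mul_pos (gaussianMatrix_pos _ _ _ _) hpq⟩

/-! ### The order defined by a transitive set -/

/-- The function is the rank: the number of elements weakly below the given one. -/
lemma exists_injective_of_isLinearOrder {ι : Type*} [Fintype ι] {r : ι → ι → Prop}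
    (hr : IsLinearOrder ι r) :
    ∃ f : ι → ℝ, Function.Injective f ∧ ∀ i j, f i ≤ f j → r i j := by
  classical
  have hlt : ∀ i j, r i j → i ≠ j →
      (Finset.univ.filter (fun a => r a i)).card < (Finset.univ.filter (fun a => r a j)).card := by
    intro i j hij hne
    refine Finset.card_lt_card (Finset.ssubset_iff_of_subset ?_ |>.2 ⟨j, ?_, ?_⟩)
    · intro a ha
      simp only [Finset.mem_filter, Finset.mem_univ, true_and] at ha ⊢
      exact hr.trans _ _ _ ha hij
    · simpa using hr.refl j
    · intro hji
      simp only [Finset.mem_filter, Finset.mem_univ, true_and] at hji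
      exact hne (hr.antisymm _ _ hij hji)
  refine ⟨fun i => ((Finset.univ.filter (fun a => r a i)).card : ℝ), ?_, ?_⟩
  · intro i j hij
    by_contra hne
    have hij' : (Finset.univ.filter (fun a => r a i)).card
        = (Finset.univ.filter (fun a => r a j)).card := by
      simpa using hij
    rcases hr.total i j with h | h
    · exact (hlt i j h hne).ne hij'
    · exact (hlt j i h (Ne.symm hne)).ne hij'.symm
  · intro i j hij
    by_contra hn
    have hne : j ≠ i := fun h => hn (h ▸ hr.refl j)
    have h := hlt j i ((hr.total i j).resolve_left hn) hne
    have hij' : (Finset.univ.filter (fun a => r a i)).card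
        ≤ (Finset.univ.filter (fun a => r a j)).card := by
      simpa using hij
    omega

lemma genMinor_eq {n : ℕ} (A : Matrix (Fin n) (Fin n) ℝ) (i j k l : Fin n) :
    genMinor A i j k l = A i k * A j l - A i l * A j k := by
  rw [genMinor, Matrix.det_fin_two]
  simp

/-- A pair outside `J` is read backwards in `W`, which flips the sign of the minor. Exactly one of
the row and column pairs is flipped when `J` separates them, and then the compound entry is
nonpositive. -/
lemma IsSignSymmetricSet.minor_le {n : ℕ} {A : Matrix (Fin n) (Fin n) ℝ} {J : Set (PairIndex n)}
    (hJ : IsSignSymmetricSet (secondCompound A) J) {i j k l : Fin n}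
    (hij : (i, j) ∈ associatedSet J) (hkl : (k, l) ∈ associatedSet J) :
    A i l * A j k ≤ A i k * A j l := by
  have hsep : ∀ a b : PairIndex n, Separates J a b →
      A a.1.1 b.1.1 * A a.1.2 b.1.2 - A a.1.1 b.1.2 * A a.1.2 b.1.1 ≤ 0 := fun a b h => by
    have := hJ.1 a b h
    rwa [secondCompound, Matrix.of_apply, genMinor_eq] at this
  have hnsep : ∀ a b : PairIndex n, ¬ Separates J a b →
      0 ≤ A a.1.1 b.1.1 * A a.1.2 b.1.2 - A a.1.1 b.1.2 * A a.1.2 b.1.1 := fun a b h => by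
    have := not_lt.1 fun hlt => h (hJ.2 a b hlt)
    rwa [secondCompound, Matrix.of_apply, genMinor_eq] at this
  rcases hij with h1 | ⟨h1, m1⟩ | ⟨h1, m1⟩
  · obtain rfl : i = j := h1
    exact (mul_comm _ _).le
  · rcases hkl with h2 | ⟨h2, m2⟩ | ⟨h2, m2⟩
    · obtain rfl : k = l := h2
      exact le_rfl
    · have := hnsep ⟨(i, j), h1⟩ ⟨(k, l), h2⟩ (by unfold Separates; tauto)
      dsimp only at this
      linarith
    · have := hsep ⟨(i, j), h1⟩ ⟨(l, k), h2⟩ (by unfold Separates; tauto)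
      dsimp only at this
      linarith
  · rcases hkl with h2 | ⟨h2, m2⟩ | ⟨h2, m2⟩
    · obtain rfl : k = l := h2
      exact le_rfl
    · have := hsep ⟨(j, i), h1⟩ ⟨(k, l), h2⟩ (by unfold Separates; tauto)
      dsimp only at this
      linarith
    · have := hnsep ⟨(j, i), h1⟩ ⟨(l, k), h2⟩ (by unfold Separates; tauto)
      dsimp only at this
      linarith

theorem theorem10 (n : ℕ) (hn : 2 ≤ n) (A : Matrix (Fin n) (Fin n) ℝ)
    (hA : ∀ i j, 0 ≤ A i j)
    (hA2 : IsJSignSymmetric (secondCompound A))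
    (hW : ∃ J : Set (PairIndex n), IsSignSymmetricSet (secondCompound A) J ∧
      IsTransitiveSet (associatedSet J)) :
    ∃ ev : Fin n → ℂ, IsEigenvalueEnumeration A ev ∧
      (∃ r : ℝ, 0 ≤ r ∧ ev ⟨0, by omega⟩ = (r : ℂ)) ∧
      (∃ s : ℝ, 0 ≤ s ∧ ev ⟨1, by omega⟩ = (s : ℂ)) := by
  obtain ⟨J, hJ, hJW⟩ := hW
  obtain ⟨f, hf, hfr⟩ := exists_injective_of_isLinearOrder hJW
  have hT : IsTotallyNonnegTwo f A :=
    ⟨hA, fun i j k l hij hkl => hJ.minor_le (hfr i j hij) (hfr k l hkl)⟩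
  obtain ⟨ev, hev⟩ := hT.exists_isGoodEnumeration hn hf
  refine ⟨ev, ⟨?_, hev.antitone⟩, ⟨_, norm_nonneg _, hev.eq_norm _ (Nat.zero_le 1)⟩,
    ⟨_, norm_nonneg _, hev.eq_norm _ le_rfl⟩⟩
  have : (A.map (algebraMap ℝ ℂ)).charpoly = ∏ i, (X - C (ev i)) :=
    Polynomial.funext fun z => by rw [hev.charpoly z, eval_prod]; simp
  rw [this, roots_prod_X_sub_C_family]
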